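/- Let $\mathcal{E}$ be an elementary topos: a category with finite limits, exponentials and a subobject classifier. Write $1$ for its terminal object and $2=1+1$. An object $Q$ is decidable if the diagonal $Q\rightarrowtail Q\times Q$ is a complemented subobject. Suppose that $\mathcal{E}$ satisfies the following two axioms. (NS) Any object $X$ of $\mathcal{E}$ is either initial or has a global element $1\to X$. (DQO) For every object $X$ there exists an epimorphism $p\colon X\to Q$ with $Q$ decidable such that every arrow $X\to 2$ factors uniquely through $p$; and it is unique, that is, for any other epimorphism $p'\colon X\to Q'$ with these properties there is an isomorphism $e\colon Q\to Q'$ with $e\circ p=p'$. For each object $X$ let $p_X\colon X\to\Pi X$ be the quotient provided by (DQO). Then for all objects $X,Y$ of $\mathcal{E}$ $$\Pi(X\times Y)\cong\Pi X\times\Pi Y,$$ by an isomorphism $e$ with $e\circ p_{X\times Y}=p_X\times p_Y$. -/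

import Mathlib

open CategoryTheory Limits MonoidalCategory CartesianMonoidalCategory

universe v u

namespace DecQuot

section

variable {E : Type u} [Category.{v} E]

/-- An arrow `m : A ⟶ X` is *complemented* if it is a summand inclusion: there is
`n : B ⟶ X` such that `m` and `n` exhibit `X` as the coproduct `A + B`. (In a topos coproduct
inclusions are monic and disjoint, and a union of disjoint subobjects is their coproduct, so this
says that `m` is a complemented subobject of `X`.) -/
def IsComplemented {A X : E} (m : A ⟶ X) : Prop :=
  ∃ (B : E) (n : B ⟶ X), Nonempty (IsColimit (BinaryCofan.mk m n))

variable [CartesianMonoidalCategory E]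

/-- An object is *decidable* if its diagonal is a complemented subobject of its square. -/
def IsDecidable (X : E) : Prop :=
  IsComplemented (lift (𝟙 X) (𝟙 X))

/-- Every arrow from `X` to `2 = 1 + 1` factors uniquely through `p : X ⟶ Q`. The object `2` is
given by its universal property: `T` ranges over all coproducts of two copies of the terminal
object. A topos has such a coproduct and any two are isomorphic, so this is a condition on any
single one of them. -/
def FactorsArrowsToTwo {X Q : E} (p : X ⟶ Q) : Prop :=
  ∀ (T : E) (i₀ i₁ : 𝟙_ E ⟶ T), Nonempty (IsColimit (BinaryCofan.mk i₀ i₁)) →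
    ∀ f : X ⟶ T, ∃! f' : Q ⟶ T, p ≫ f' = f

/-- `p : X ⟶ Q` is a decidable quotient of `X` along which any arrow to `2` factors uniquely. -/
structure IsDecidableQuotient {X Q : E} (p : X ⟶ Q) : Prop where
  epi : Epi p
  decidable : IsDecidable Q
  factors : FactorsArrowsToTwo p

variable (E)

/-- The Nullstellensatz: any object is either initial or has a global element. -/
def NS : Prop :=
  ∀ X : E, Nonempty (IsInitial X) ∨ Nonempty (𝟙_ E ⟶ X)

/-- Every object has a unique (up to isomorphism under the object) decidable quotient along which
any arrow to `2` factors uniquely. -/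
def DQO : Prop :=
  ∀ X : E, ∃ (Q : E) (p : X ⟶ Q), IsDecidableQuotient p ∧
    ∀ (Q' : E) (p' : X ⟶ Q'), IsDecidableQuotient p' → ∃ e : Q ≅ Q', p ≫ e.hom = p'

variable {E}

/-- The decidable quotient `Π X`. -/
noncomputable def DQO.Pi (h : DQO E) (X : E) : E :=
  (h X).choose

/-- The quotient map `p_X : X ⟶ Π X`. -/
noncomputable def DQO.p (h : DQO E) (X : E) : X ⟶ h.Pi X :=
  (h X).choose_spec.choose

end

end DecQuot

/-! By the uniqueness clause of (DQO) it is enough that `p_X × p_Y` is itself a decidable quotient.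
It is epi because products with a fixed object are left adjoints. Its target is decidable because
its diagonal is a composite of complemented arrows. For the factorization, extend `f : X × Y ⟶ 2`
one variable at a time (`exists_factor_whiskerLeft`). Epimorphisms in a topos are coequalizers of
their kernel pairs, so `f` must identify any two elements with the same image under `X × p_Y`. By
(NS), equality of arrows to `2` can be tested on points (`eq_of_points_eq`), and over a point `x`
the slice `f(x, -) : Y ⟶ 2` factors through `p_Y`. -/

namespace DecQuot

open HasSubobjectClassifier

/-! ### Complemented arrows, decidable products and epimorphisms. -/

section Sums

variable {E : Type u} [Category.{v} E]

/-- A cocone on two objects is a coproduct as soon as arrows out of it can be defined by cases and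
are determined by their two components. -/
lemma nonempty_isColimit_binaryCofan {A B X : E} {m : A ⟶ X} {n : B ⟶ X}
    (hdesc : ∀ (W : E) (a : A ⟶ W) (b : B ⟶ W), ∃ f : X ⟶ W, m ≫ f = a ∧ n ≫ f = b)
    (hext : ∀ (W : E) (f g : X ⟶ W), m ≫ f = m ≫ g → n ≫ f = n ≫ g → f = g) :
    Nonempty (IsColimit (BinaryCofan.mk m n)) := by
  choose d hd₁ hd₂ using hdesc
  exact ⟨BinaryCofan.isColimitMk (fun s => d _ s.inl s.inr) (fun s => hd₁ _ _ _)
    (fun s => hd₂ _ _ _) (fun s k h₁ h₂ =>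
      hext _ _ _ (h₁.trans (hd₁ _ _ _).symm) (h₂.trans (hd₂ _ _ _).symm))⟩

lemma exists_desc {A B X : E} {m : A ⟶ X} {n : B ⟶ X}
    (h : Nonempty (IsColimit (BinaryCofan.mk m n))) {W : E} (a : A ⟶ W) (b : B ⟶ W) :
    ∃ f : X ⟶ W, m ≫ f = a ∧ n ≫ f = b := by
  obtain ⟨h⟩ := h
  obtain ⟨f, hf₁, hf₂⟩ := BinaryCofan.IsColimit.desc' h a b
  exact ⟨f, hf₁, hf₂⟩

lemma sum_hom_ext {A B X : E} {m : A ⟶ X} {n : B ⟶ X}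
    (h : Nonempty (IsColimit (BinaryCofan.mk m n))) {W : E} {f g : X ⟶ W}
    (h₁ : m ≫ f = m ≫ g) (h₂ : n ≫ f = n ≫ g) : f = g :=
  BinaryCofan.IsColimit.hom_ext h.some h₁ h₂

lemma IsComplemented.comp_iso {A X X' : E} {m : A ⟶ X} (h : IsComplemented m) (e : X ≅ X') :
    IsComplemented (m ≫ e.hom) := by
  obtain ⟨B, n, h⟩ := h
  refine ⟨B, n ≫ e.hom, nonempty_isColimit_binaryCofan (fun W a b => ?_)
    (fun W f g h₁ h₂ => ?_)⟩
  · obtain ⟨f, hf₁, hf₂⟩ := exists_desc h a b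
    exact ⟨e.inv ≫ f, by simp [hf₁], by simp [hf₂]⟩
  · rw [← cancel_epi e.hom]
    exact sum_hom_ext h (by simpa using h₁) (by simpa using h₂)

variable [CartesianMonoidalCategory E]

/-- Under the Nullstellensatz, two summands `A'`, `Y'` of `X = (A + A') + Y'` have a coproduct: it
is obtained by splitting an idempotent of `X` that collapses `A` to a point of `A'`. -/
lemma IsComplemented.comp [HasFiniteLimits E] (hNS : NS E) {A Y X : E} {m : A ⟶ Y} {n : Y ⟶ X}
    (hm : IsComplemented m) (hn : IsComplemented n) : IsComplemented (m ≫ n) := by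
  obtain ⟨A', m', hm⟩ := hm
  obtain ⟨Y', n', hn⟩ := hn
  rcases hNS A' with ⟨⟨hA'⟩⟩ | ⟨⟨t⟩⟩
  -- With `A'` initial, `Y'` alone is a complement of `A`.
  · refine ⟨Y', n', nonempty_isColimit_binaryCofan (fun W a b => ?_)
      (fun W f g h₁ h₂ => sum_hom_ext hn (sum_hom_ext hm ?_ (hA'.hom_ext _ _)) h₂)⟩
    · obtain ⟨c, hc, -⟩ := exists_desc hm a (hA'.to W)
      obtain ⟨f, hf₁, hf₂⟩ := exists_desc hn c b
      exact ⟨f, by rw [Category.assoc, hf₁, hc], hf₂⟩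
    · simpa using h₁
  · obtain ⟨r, hr₁, hr₂⟩ := exists_desc hm (toUnit A ≫ t ≫ m' ≫ n) (m' ≫ n)
    obtain ⟨e, he₁, he₂⟩ := exists_desc hn r n'
    have hme : m ≫ n ≫ e = toUnit A ≫ t ≫ m' ≫ n := by rw [he₁, hr₁]
    have hm'e : m' ≫ n ≫ e = m' ≫ n := by rw [he₁, hr₂]
    have hee : e ≫ e = e ≫ 𝟙 X := by
      refine sum_hom_ext hn (sum_hom_ext hm ?_ ?_) ?_
      · simp [reassoc_of% hme, hm'e, hme]
      · simp [reassoc_of% hm'e, hm'e]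
      · simp [reassoc_of% he₂, he₂]
    let s : X ⟶ equalizer e (𝟙 X) := equalizer.lift e hee
    have hs : s ≫ equalizer.ι e (𝟙 X) = e := equalizer.lift_ι _ _
    have hιs : equalizer.ι e (𝟙 X) ≫ s = 𝟙 _ := by
      ext
      simpa [hs] using equalizer.condition e (𝟙 X)
    refine ⟨equalizer e (𝟙 X), equalizer.ι e (𝟙 X),
      nonempty_isColimit_binaryCofan (fun W a b => ?_) (fun W f g h₁ h₂ => ?_)⟩
    · obtain ⟨c, hc₁, hc₂⟩ := exists_desc hm a (m' ≫ n ≫ s ≫ b)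
      obtain ⟨f, hf₁, hf₂⟩ := exists_desc hn c (n' ≫ s ≫ b)
      refine ⟨f, by rw [Category.assoc, hf₁, hc₁], ?_⟩
      have key : e ≫ f = s ≫ b := by
        have hes : e ≫ s = s := by
          have := congrArg (· ≫ s) hs
          simpa [hιs] using this.symm
        refine sum_hom_ext hn (sum_hom_ext hm ?_ ?_) ?_
        · rw [reassoc_of% hme, hf₁, hc₂, ← reassoc_of% hme, reassoc_of% hes]
        · rw [reassoc_of% hm'e, hf₁, hc₂]
        · rw [reassoc_of% he₂, hf₂]
      have := equalizer.condition e (𝟙 X) =≫ f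
      simp only [Category.assoc, key, Category.comp_id, reassoc_of% hιs] at this
      exact this.symm
    · have hef : e ≫ f = e ≫ g := by rw [← hs, Category.assoc, Category.assoc, h₂]
      refine sum_hom_ext hn (sum_hom_ext hm (by simpa using h₁) ?_) ?_
      · rw [← reassoc_of% hm'e, hef, reassoc_of% hm'e]
      · rw [← reassoc_of% he₂, hef, reassoc_of% he₂]

variable [MonoidalClosed E]

lemma whiskerLeft_sum {A B X : E} {m : A ⟶ X} {n : B ⟶ X}
    (h : Nonempty (IsColimit (BinaryCofan.mk m n))) (Z : E) :
    Nonempty (IsColimit (BinaryCofan.mk (Z ◁ m) (Z ◁ n))) :=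
  h.map fun h => mapIsColimitOfPreservesOfIsColimit (tensorLeft Z) m n h

lemma whiskerRight_sum {A B X : E} {m : A ⟶ X} {n : B ⟶ X}
    (h : Nonempty (IsColimit (BinaryCofan.mk m n))) (Z : E) :
    Nonempty (IsColimit (BinaryCofan.mk (m ▷ Z) (n ▷ Z))) := by
  let _ : BraidedCategory E := .ofCartesianMonoidalCategory
  have h := whiskerLeft_sum h Z
  refine nonempty_isColimit_binaryCofan (fun W a b => ?_) (fun W f g h₁ h₂ => ?_)
  · obtain ⟨f, hf₁, hf₂⟩ := exists_desc h ((β_ Z A).hom ≫ a) ((β_ Z B).hom ≫ b)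
    refine ⟨(β_ X Z).hom ≫ f, ?_, ?_⟩
    · rw [BraidedCategory.braiding_naturality_left_assoc, hf₁, SymmetricCategory.symmetry_assoc]
    · rw [BraidedCategory.braiding_naturality_left_assoc, hf₂, SymmetricCategory.symmetry_assoc]
  · rw [← cancel_epi (β_ Z X).hom]
    exact sum_hom_ext h
      (by simpa only [BraidedCategory.braiding_naturality_right_assoc] using (β_ Z A).hom ≫= h₁)
      (by simpa only [BraidedCategory.braiding_naturality_right_assoc] using (β_ Z B).hom ≫= h₂)

lemma IsComplemented.whiskerLeft {A X : E} {m : A ⟶ X} (h : IsComplemented m) (Z : E) :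
    IsComplemented (Z ◁ m) := by
  obtain ⟨B, n, h⟩ := h
  exact ⟨Z ⊗ B, Z ◁ n, whiskerLeft_sum h Z⟩

lemma IsComplemented.whiskerRight {A X : E} {m : A ⟶ X} (h : IsComplemented m) (Z : E) :
    IsComplemented (m ▷ Z) := by
  obtain ⟨B, n, h⟩ := h
  exact ⟨B ⊗ Z, n ▷ Z, whiskerRight_sum h Z⟩

/-- Up to middle interchange, the diagonal of `P ⊗ Q` is the diagonal of `Q` followed by that of
`P`, each multiplied by a fixed object. -/
lemma IsDecidable.tensor [HasFiniteLimits E] (hNS : NS E) {P Q : E} (hP : IsDecidable P)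
    (hQ : IsDecidable Q) : IsDecidable (P ⊗ Q) := by
  let _ : BraidedCategory E := .ofCartesianMonoidalCategory
  have h := (IsComplemented.comp hNS (hQ.whiskerLeft P) (hP.whiskerRight (Q ⊗ Q))).comp_iso
    ⟨tensorμ P P Q Q, tensorδ P P Q Q, by simp, by simp⟩
  have e : (P ◁ lift (𝟙 Q) (𝟙 Q) ≫ lift (𝟙 P) (𝟙 P) ▷ (Q ⊗ Q)) ≫ tensorμ P P Q Q =
      lift (𝟙 (P ⊗ Q)) (𝟙 (P ⊗ Q)) := by
    ext <;> simp
  rw [IsDecidable, ← e]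
  exact h

lemma epi_whiskerLeft {X Y : E} (p : X ⟶ Y) [Epi p] (Z : E) : Epi (Z ◁ p) :=
  inferInstanceAs (Epi ((tensorLeft Z).map p))

lemma epi_whiskerRight {X Y : E} (p : X ⟶ Y) [Epi p] (Z : E) : Epi (p ▷ Z) := by
  let _ : BraidedCategory E := .ofCartesianMonoidalCategory
  have := epi_whiskerLeft p Z
  have e : p ▷ Z = (β_ X Z).hom ≫ Z ◁ p ≫ (β_ Z Y).hom := by ext <;> simp
  rw [e]
  infer_instance

end Sums

/-! ### Arrows to `Ω` as predicates on generalized elements. -/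

section Truth

variable {E : Type u} [Category.{v} E] [HasSubobjectClassifier E]

/-- The arrow to `Ω` with constant value true. -/
noncomputable def constTrue (X : E) : X ⟶ Ω E :=
  Subobject.Classifier.χ₀ _ X ≫ truth E

lemma comp_constTrue {X Y : E} (f : X ⟶ Y) : f ≫ constTrue Y = constTrue X := by
  rw [constTrue, constTrue, ← Category.assoc]
  exact congrArg (· ≫ truth E) (Subobject.Classifier.isTerminalΩ₀.hom_ext _ _)

lemma comp_χ_eq_constTrue_iff {U X V : E} (m : U ⟶ X) [Mono m] (t : V ⟶ X) :
    t ≫ χ m = constTrue V ↔ ∃ l : V ⟶ U, l ≫ m = t := by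
  constructor
  · intro h
    exact ⟨(isPullback_χ m).lift t _ h, (isPullback_χ m).lift_fst _ _ _⟩
  · rintro ⟨l, rfl⟩
    rw [Category.assoc, comm m]
    exact comp_constTrue l

lemma omega_hom_ext [HasFiniteLimits E] {X : E} {φ ψ : X ⟶ Ω E}
    (h : ∀ (V : E) (t : V ⟶ X), t ≫ φ = constTrue V ↔ t ≫ ψ = constTrue V) : φ = ψ := by
  obtain ⟨U, i, _, rfl⟩ := Subobject.Classifier.surjective_χ _ φ
  refine (unique i ψ ⟨⟨((h U i).1 ((comp_χ_eq_constTrue_iff i i).2 ⟨𝟙 _, by simp⟩))⟩, ⟨?_⟩⟩).symm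
  have hl : ∀ s : PullbackCone ψ (truth E), ∃ l : s.pt ⟶ U, l ≫ i = s.fst := fun s => by
    refine (comp_χ_eq_constTrue_iff i s.fst).1 ((h _ _).2 ?_)
    rw [s.condition]
    exact congrArg (· ≫ truth E) (Subobject.Classifier.isTerminalΩ₀.hom_ext _ _)
  choose l hl using hl
  exact PullbackCone.IsLimit.mk _ l hl
    (fun s => Subobject.Classifier.isTerminalΩ₀.hom_ext _ _)
    (fun s k hk _ => by rw [← cancel_mono i, hk, hl])

end Truth

/-! ### Descent along epimorphisms and factorization of arrows to `2`. -/

section Topos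

variable {E : Type u} [Category.{v} E] [CartesianMonoidalCategory E] [HasFiniteLimits E]
  [MonoidalClosed E] [HasSubobjectClassifier E]

/-- The two inclusions of a coproduct `T` are jointly epimorphic after pulling back along any
arrow `g : Z ⟶ T`. -/
lemma hom_ext_of_sum {A B T : E} {i₀ : A ⟶ T} {i₁ : B ⟶ T}
    (hT : Nonempty (IsColimit (BinaryCofan.mk i₀ i₁))) {Z W : E} (g : Z ⟶ T) {a b : Z ⟶ W}
    (h₀ : ∀ (V : E) (z : V ⟶ Z) (s : V ⟶ A), z ≫ g = s ≫ i₀ → z ≫ a = z ≫ b)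
    (h₁ : ∀ (V : E) (z : V ⟶ Z) (s : V ⟶ B), z ≫ g = s ≫ i₁ → z ≫ a = z ≫ b) : a = b := by
  -- The graph of `g` and its restriction to the equalizer of `a` and `b` agree on both summands of
  -- `T ⊗ Z`, hence are equal; so the equalizer is all of `Z`.
  let γ : Z ⟶ T ⊗ Z := lift g (𝟙 Z)
  have : Mono γ := mono_of_mono_fac (lift_snd g (𝟙 Z))
  have aux : ∀ {C : E} (i : C ⟶ T),
      (∀ (V : E) (z : V ⟶ Z) (s : V ⟶ C), z ≫ g = s ≫ i → z ≫ a = z ≫ b) →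
      i ▷ Z ≫ χ γ = i ▷ Z ≫ χ (equalizer.ι a b ≫ γ) := by
    intro C i hi
    refine omega_hom_ext fun V t => ?_
    rw [← Category.assoc, ← Category.assoc, comp_χ_eq_constTrue_iff, comp_χ_eq_constTrue_iff]
    constructor
    · rintro ⟨l, hl⟩
      have hl₁ : l ≫ g = (t ≫ fst _ _) ≫ i := by
        simpa [γ] using hl =≫ fst _ _
      exact ⟨equalizer.lift l (hi V l _ hl₁), by simpa using hl⟩
    · rintro ⟨l, hl⟩
      exact ⟨l ≫ equalizer.ι a b, by simpa using hl⟩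
  have hχ : χ γ = χ (equalizer.ι a b ≫ γ) :=
    sum_hom_ext (whiskerRight_sum hT Z) (aux i₀ h₀) (aux i₁ h₁)
  obtain ⟨l, hl⟩ := (comp_χ_eq_constTrue_iff (equalizer.ι a b ≫ γ) γ).1
    (hχ ▸ (comp_χ_eq_constTrue_iff γ γ).2 ⟨𝟙 _, Category.id_comp _⟩)
  have hl' : l ≫ equalizer.ι a b = 𝟙 Z := by simpa [γ] using hl =≫ snd _ _
  rw [← Category.id_comp a, ← hl', Category.assoc, equalizer.condition, reassoc_of% hl']

/-- An arrow to `Ω` that coequalizes the kernel pair of `q` extends along `q`. -/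
lemma exists_extension_omega {Z Z' : E} (q : Z ⟶ Z') (f : Z ⟶ Ω E)
    (hf : ∀ (V : E) (a b : V ⟶ Z), a ≫ q = b ≫ q → a ≫ f = b ≫ f) :
    ∃ f' : Z' ⟶ Ω E, q ≫ f' = f := by
  obtain ⟨S, i, _, rfl⟩ := Subobject.Classifier.surjective_χ _ f
  let γ : Z ⟶ Z ⊗ Z' := lift (𝟙 Z) q
  have : Mono γ := mono_of_mono_fac (lift_fst (𝟙 Z) q)
  -- `u` sends `z'` to its fibre under `q`, `w` to the part of that fibre in `S`. Their equalizer is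
  -- the universal image of `S` along `q`; it pulls back to `S` because `S` is a union of fibres.
  let u := MonoidalClosed.curry (χ γ)
  let w := MonoidalClosed.curry (χ (i ≫ γ))
  refine ⟨χ (equalizer.ι u w), omega_hom_ext fun V t => ?_⟩
  have hmem : t ≫ q ≫ χ (equalizer.ι u w) = constTrue V ↔ (t ≫ q) ≫ u = (t ≫ q) ≫ w := by
    rw [← Category.assoc, comp_χ_eq_constTrue_iff]
    constructor
    · rintro ⟨l, hl⟩
      rw [← hl, Category.assoc, Category.assoc, equalizer.condition]
    · intro h
      exact ⟨equalizer.lift _ h, equalizer.lift_ι _ _⟩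
  rw [hmem, ← MonoidalClosed.curry_natural_left, ← MonoidalClosed.curry_natural_left,
    MonoidalClosed.curry_injective.eq_iff]
  change _ ↔ t ≫ χ i = _
  constructor
  · intro h
    have h' := lift t (𝟙 V) ≫= h
    have e : lift t (𝟙 V) ≫ Z ◁ (t ≫ q) = t ≫ γ := by ext <;> simp [γ]
    rw [reassoc_of% e, reassoc_of% e, ← Category.assoc, ← Category.assoc,
      (comp_χ_eq_constTrue_iff γ (t ≫ γ)).2 ⟨t, rfl⟩] at h'
    obtain ⟨l, hl⟩ := (comp_χ_eq_constTrue_iff (i ≫ γ) (t ≫ γ)).1 h'.symm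
    rw [← Category.assoc, cancel_mono] at hl
    exact (comp_χ_eq_constTrue_iff i t).2 ⟨l, hl⟩
  · intro h
    refine omega_hom_ext fun V' z => ?_
    rw [← Category.assoc, ← Category.assoc, comp_χ_eq_constTrue_iff, comp_χ_eq_constTrue_iff]
    constructor
    · rintro ⟨l, hl⟩
      have hl₂ : l ≫ q = (z ≫ snd _ _ ≫ t) ≫ q := by simpa [γ] using hl =≫ snd _ _
      have hli : l ≫ χ i = constTrue V' := by
        refine (hf V' _ _ hl₂).trans ?_
        change (z ≫ snd _ _ ≫ t) ≫ χ i = _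
        rw [Category.assoc, Category.assoc, h, comp_constTrue, comp_constTrue]
      obtain ⟨k, rfl⟩ := (comp_χ_eq_constTrue_iff i l).1 hli
      exact ⟨k, by simpa using hl⟩
    · rintro ⟨l, hl⟩
      exact ⟨l ≫ i, by simpa using hl⟩

/-- The arrow `W ⟶ Ω ^ W` sending an element to its singleton. -/
noncomputable def singleton (W : E) : W ⟶ (ihom W).obj (Ω E) :=
  have : Mono (lift (𝟙 W) (𝟙 W)) := mono_of_mono_fac (lift_fst _ _)
  MonoidalClosed.curry (χ (lift (𝟙 W) (𝟙 W)))

instance mono_singleton (W : E) : Mono (singleton W) where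
  right_cancellation {V} f g h := by
    have : Mono (lift (𝟙 W) (𝟙 W)) := mono_of_mono_fac (lift_fst _ _)
    rw [singleton, ← MonoidalClosed.curry_natural_left, ← MonoidalClosed.curry_natural_left,
      MonoidalClosed.curry_injective.eq_iff] at h
    have h' := lift f (𝟙 V) ≫= h
    rw [← Category.assoc, ← Category.assoc, (comp_χ_eq_constTrue_iff _ _).2
      ⟨f, by ext <;> simp⟩] at h'
    obtain ⟨l, hl⟩ := (comp_χ_eq_constTrue_iff _ _).1 h'.symm
    have h₁ : l = f := by simpa using hl =≫ fst _ _
    have h₂ : l = g := by simpa using hl =≫ snd _ _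
    exact h₁.symm.trans h₂

/-- In a topos an epimorphism is the coequalizer of its kernel pair. -/
lemma exists_extension_of_epi {Z Z' W : E} (q : Z ⟶ Z') [Epi q] (f : Z ⟶ W)
    (hf : ∀ (V : E) (a b : V ⟶ Z), a ≫ q = b ≫ q → a ≫ f = b ≫ f) :
    ∃ f' : Z' ⟶ W, q ≫ f' = f := by
  -- The predicate `w = f z` descends to `W ⊗ Z'`, so the transpose of `k` sends `q z` to the
  -- singleton of `f z`. Lifting the epi `q` against the mono `singleton W` then gives the
  -- extension.
  obtain ⟨k, hk⟩ := exists_extension_omega (W ◁ q) (MonoidalClosed.uncurry (f ≫ singleton W))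
    (fun V a b hab => by
      have h₁ : a ≫ fst _ _ = b ≫ fst _ _ := by simpa using hab =≫ fst _ _
      have h₂ : (a ≫ snd _ _) ≫ q = (b ≫ snd _ _) ≫ q := by simpa using hab =≫ snd _ _
      have h₃ := hf V _ _ h₂
      have h₄ : a ≫ W ◁ f = b ≫ W ◁ f := by
        ext
        · simpa using h₁
        · simpa using h₃
      rw [MonoidalClosed.uncurry_natural_left, reassoc_of% h₄])
  have sq : CommSq f q (singleton W) (MonoidalClosed.curry k) := ⟨by
    rw [← MonoidalClosed.curry_natural_left, hk, MonoidalClosed.curry_uncurry]⟩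
  have : StrongMono (singleton W) := strongMono_of_mono _
  exact ⟨sq.lift, sq.fac_left⟩

/-- Split `Z` according to the values of `a` and `b`. A piece where they differ has no point, since
a point would force `i₀ = i₁`, so by (NS) it is initial. -/
lemma eq_of_points_eq (hNS : NS E) {T : E} {i₀ i₁ : 𝟙_ E ⟶ T}
    (hT : Nonempty (IsColimit (BinaryCofan.mk i₀ i₁))) {Z : E} {a b : Z ⟶ T}
    (h : ∀ z : 𝟙_ E ⟶ Z, z ≫ a = z ≫ b) : a = b := by
  by_cases hi : i₀ = i₁
  -- In the degenerate case `T` is terminal.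
  · have hid : 𝟙 T = toUnit T ≫ i₀ :=
      sum_hom_ext hT (by simp [reassoc_of% toUnit_unique (i₀ ≫ toUnit T) (𝟙 _)])
        (by simp [reassoc_of% toUnit_unique (i₁ ≫ toUnit T) (𝟙 _), hi])
    rw [← Category.comp_id a, ← Category.comp_id b, hid, ← Category.assoc, ← Category.assoc,
      toUnit_unique (a ≫ toUnit T) (b ≫ toUnit T)]
  have disjoint : ∀ (V : E) (z : V ⟶ Z) (x y : 𝟙_ E ⟶ T), x ≠ y → z ≫ a = toUnit V ≫ x →
      z ≫ b = toUnit V ≫ y → z ≫ a = z ≫ b := by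
    intro V z x y hxy hx hy
    rcases hNS V with ⟨⟨hV⟩⟩ | ⟨⟨v⟩⟩
    · exact hV.hom_ext _ _
    · refine absurd ?_ hxy
      have := h (v ≫ z)
      rw [Category.assoc, Category.assoc, hx, hy] at this
      simpa [reassoc_of% toUnit_unique (v ≫ toUnit V) (𝟙 _)] using this
  refine hom_ext_of_sum hT a (fun V z s hs => hom_ext_of_sum hT (z ≫ b) ?_ ?_)
    (fun V z s hs => hom_ext_of_sum hT (z ≫ b) ?_ ?_)
  all_goals
    intro V' z' s' hs'
    obtain rfl := toUnit_unique s (toUnit V)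
    obtain rfl := toUnit_unique s' (toUnit V')
    have hs'' := z' ≫= hs
    rw [← Category.assoc, ← Category.assoc, toUnit_unique (z' ≫ toUnit V) (toUnit V')] at hs''
    rw [← Category.assoc] at hs'
    rw [← Category.assoc, ← Category.assoc]
  · rw [hs', hs'']
  · exact disjoint _ _ _ _ hi hs'' hs'
  · exact disjoint _ _ _ _ (Ne.symm hi) hs'' hs'
  · rw [hs', hs'']

lemma exists_factor_whiskerLeft (hNS : NS E) {Y Q : E} (p : Y ⟶ Q) [Epi p]
    (hp : FactorsArrowsToTwo p) (X : E) {T : E} {i₀ i₁ : 𝟙_ E ⟶ T}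
    (hT : Nonempty (IsColimit (BinaryCofan.mk i₀ i₁))) (f : X ⊗ Y ⟶ T) :
    ∃ f' : X ⊗ Q ⟶ T, X ◁ p ≫ f' = f := by
  have := epi_whiskerLeft p X
  refine exists_extension_of_epi (X ◁ p) f fun V a b hab => eq_of_points_eq hNS hT fun z => ?_
  have h₁ : z ≫ a ≫ fst _ _ = z ≫ b ≫ fst _ _ := by simpa using z ≫= hab =≫ fst _ _
  have h₂ : (z ≫ a ≫ snd _ _) ≫ p = (z ≫ b ≫ snd _ _) ≫ p := by
    simpa using z ≫= hab =≫ snd _ _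
  let x : 𝟙_ E ⟶ X := z ≫ a ≫ fst _ _
  -- `g` factors the slice of `f` at the common first coordinate `x` of the two points.
  obtain ⟨g, hg, -⟩ := hp T i₀ i₁ hT (lift (toUnit Y ≫ x) (𝟙 Y) ≫ f)
  have slice : ∀ c : 𝟙_ E ⟶ X ⊗ Y, c ≫ fst _ _ = x →
      c ≫ f = (c ≫ snd _ _) ≫ p ≫ g := by
    intro c hc
    rw [hg, ← Category.assoc]
    congr 1
    ext
    · simp [hc]
    · simp
  rw [← Category.assoc, ← Category.assoc, slice (z ≫ a) (by simp [x]),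
    slice (z ≫ b) (by simp [x, h₁]), ← Category.assoc, ← Category.assoc]
  exact congrArg (· ≫ g) (by simpa using h₂)

lemma exists_factor_whiskerRight (hNS : NS E) {X Q : E} (p : X ⟶ Q) [Epi p]
    (hp : FactorsArrowsToTwo p) (Y : E) {T : E} {i₀ i₁ : 𝟙_ E ⟶ T}
    (hT : Nonempty (IsColimit (BinaryCofan.mk i₀ i₁))) (f : X ⊗ Y ⟶ T) :
    ∃ f' : Q ⊗ Y ⟶ T, p ▷ Y ≫ f' = f := by
  let _ : BraidedCategory E := .ofCartesianMonoidalCategory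
  obtain ⟨f', hf'⟩ := exists_factor_whiskerLeft hNS p hp Y hT ((β_ Y X).hom ≫ f)
  refine ⟨(β_ Q Y).hom ≫ f', ?_⟩
  rw [BraidedCategory.braiding_naturality_left_assoc, hf', SymmetricCategory.symmetry_assoc]

lemma IsDecidableQuotient.tensorHom (hNS : NS E) {X Y P Q : E} {p : X ⟶ P} {q : Y ⟶ Q}
    (hp : IsDecidableQuotient p) (hq : IsDecidableQuotient q) :
    IsDecidableQuotient (p ⊗ₘ q) := by
  have := hp.epi
  have := hq.epi
  have := epi_whiskerLeft q X
  have := epi_whiskerRight p Q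
  have e : p ⊗ₘ q = X ◁ q ≫ p ▷ Q := MonoidalCategory.tensorHom_def' p q
  have hepi : Epi (p ⊗ₘ q) := e ▸ inferInstance
  refine ⟨hepi, hp.decidable.tensor hNS hq.decidable, fun T i₀ i₁ hT f => ?_⟩
  obtain ⟨g, hg⟩ := exists_factor_whiskerLeft hNS q hq.factors X hT f
  obtain ⟨k, hk⟩ := exists_factor_whiskerRight hNS p hp.factors Q hT g
  have hk' : (p ⊗ₘ q) ≫ k = f := by rw [e, Category.assoc, hk, hg]
  exact ⟨k, hk', fun k' h => by rw [← cancel_epi (p ⊗ₘ q), h, hk']⟩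

end Topos

end DecQuot

theorem corollaryT {E : Type u} [Category.{v} E] [CartesianMonoidalCategory E] [HasFiniteLimits E]
    [MonoidalClosed E] [HasSubobjectClassifier E]
    (hNS : DecQuot.NS E) (hDQO : DecQuot.DQO E) (X Y : E) :
    ∃ e : hDQO.Pi (X ⊗ Y) ≅ hDQO.Pi X ⊗ hDQO.Pi Y,
      hDQO.p (X ⊗ Y) ≫ e.hom = hDQO.p X ⊗ₘ hDQO.p Y :=
  (hDQO (X ⊗ Y)).choose_spec.choose_spec.2 _ _
    (.tensorHom hNS (hDQO X).choose_spec.choose_spec.1 (hDQO Y).choose_spec.choose_spec.1)
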